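/- Let $\mathbb N$ be the set of positive integers, let $k\ge 2$ be an integer, and write $\binom{\mathbb N}{k}$ for the set of all $k$-element subsets of $\mathbb N$. For an infinite set $X=\{x_1<x_2<\cdots\}\subseteq\mathbb N$ let $X_{sum}=\{\sum_{j\in J}x_j : J\in\binom{\mathbb N}{k}\}$. Call $X$ nondegenerate if $\sum_{i\in I}x_i\neq\sum_{j\in J}x_j$ for all distinct $I,J\in\binom{\mathbb N}{k}$ and $X\cap X_{sum}=\emptyset$. For a coloring $\Delta\colon\mathbb N\to\mathbb N$, a set $S\subseteq\mathbb N$ is monochromatic if all its elements have the same color, and rainbow if distinct elements of $S$ have distinct colors. Consider the following patterns for $X$ and $\Delta$: (i) $X\cup X_{sum}$ is monochromatic; (ii) $X\cup X_{sum}$ is rainbow; (iii) $X$ is rainbow and $\Delta(\sum_{j\in J}x_j)=\Delta(x_{\max J})$ for all $J\in\binom{\mathbb N}{k}$; (iv) $X$ is rainbow and $\Delta(\sum_{j\in J}x_j)=\Delta(x_{\min J})$ for all $J\in\binom{\mathbb N}{k}$; (v) $X$ is rainbow, $\Delta(X)\cap\Delta(X_{sum})=\emptyset$, and for all $I,J\in\binom{\mathbb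 N}{k}$ one has $\Delta(\sum_{j\in J}x_j)=\Delta(\sum_{i\in I}x_i)$ if and only if $\min I=\min J$ and $\max I=\max J$. Then for every coloring $\Delta\colon\mathbb N\to\mathbb N$ there is an infinite set $X\subseteq\mathbb N$, which can moreover be taken nondegenerate, that follows at least one of the patterns (i)–(v). For $k=2$ patterns (ii) and (v) coincide for nondegenerate sets; more precisely, for every coloring $\Delta$ an infinite set $X$ follows (v) if and only if it is nondegenerate and follows (ii). None of the patterns can be omitted: if $k\ge 3$, then for each of the five patterns there is a coloring $\Delta\colon\mathbb N\to\mathbb N$ for which no infinite set $X$ follows any of the other four patterns. If $k=2$, then the same holds for the four patterns (i), (ii)/(v), (iii), (iv), where (ii) and (v) count as one pattern: for each of them there is a coloring for which no infinite set $X$ follows any of the others. -/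

import Mathlib

namespace KSum

/-- `x` lists an infinite set of positive integers in increasing order, `x 0 < x 1 < ⋯`;
the set `X` itself is `Set.range x`. -/
def Enumerates (x : ℕ → ℕ) : Prop :=
  StrictMono x ∧ ∀ i, 0 < x i

/-- The set `X_sum(k)` of all sums `∑ j ∈ J, x j`, where `J` is a `k`-element set of indices. -/
def sums (k : ℕ) (x : ℕ → ℕ) : Set ℕ :=
  {s | ∃ J : Finset ℕ, J.card = k ∧ ∑ j ∈ J, x j = s}

/-- A set of integers is monochromatic if all its elements have the same color. -/
def Monochromatic (Δ : ℕ → ℕ) (S : Set ℕ) : Prop :=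
  ∀ a ∈ S, ∀ b ∈ S, Δ a = Δ b

/-- A set of integers is rainbow if its elements have pairwise distinct colors. -/
def Rainbow (Δ : ℕ → ℕ) (S : Set ℕ) : Prop :=
  ∀ a ∈ S, ∀ b ∈ S, Δ a = Δ b → a = b

/-- Different `k`-element index sets give different sums, and no such sum lies in `X`. -/
def Nondegenerate (k : ℕ) (x : ℕ → ℕ) : Prop :=
  (∀ I J : Finset ℕ, I.card = k → J.card = k → ∑ i ∈ I, x i = ∑ j ∈ J, x j → I = J) ∧
    Disjoint (Set.range x) (sums k x)

/-- Names for the five color patterns (i), (ii), (iii), (iv), (v), in this order. -/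
inductive Pattern : Type
  | mono
  | rainbow
  | max
  | min
  | minMax

/-- `Follows k Δ x p`: the sets `X` and `X_sum(k)` are colored by `Δ` according to the
pattern `p`. The values of `Δ` are only used at positive integers. -/
def Follows (k : ℕ) (Δ : ℕ → ℕ) (x : ℕ → ℕ) : Pattern → Prop
  | .mono => Monochromatic Δ (Set.range x ∪ sums k x)
  | .rainbow => Rainbow Δ (Set.range x ∪ sums k x)
  | .max => Rainbow Δ (Set.range x) ∧
      ∀ (J : Finset ℕ) (hJ : J.Nonempty), J.card = k → Δ (∑ j ∈ J, x j) = Δ (x (J.max' hJ))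
  | .min => Rainbow Δ (Set.range x) ∧
      ∀ (J : Finset ℕ) (hJ : J.Nonempty), J.card = k → Δ (∑ j ∈ J, x j) = Δ (x (J.min' hJ))
  | .minMax => Rainbow Δ (Set.range x) ∧
      (∀ (I J : Finset ℕ) (hI : I.Nonempty) (hJ : J.Nonempty), I.card = k → J.card = k →
        (Δ (∑ j ∈ J, x j) = Δ (∑ i ∈ I, x i) ↔
          I.min' hI = J.min' hJ ∧ I.max' hI = J.max' hJ)) ∧
      Disjoint (Δ '' Set.range x) (Δ '' sums k x)

/-- `p` and `q` count as the same pattern for `k`-term sums: they are equal, or `k = 2` and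
they are the patterns (ii) and (v), in either order. -/
def SamePattern (k : ℕ) (p q : Pattern) : Prop :=
  p = q ∨ (k = 2 ∧ ((p = .rainbow ∧ q = .minMax) ∨ (p = .minMax ∧ q = .rainbow)))

end KSum

/-!
A canonical Ramsey theorem for an integer sequence and its `k`-fold sums.

*Existence.* Fix a nonprincipal ultrafilter `U` on `ℕ` that is idempotent for addition. Diagonalizing
over `U` gives a sequence `x`, growing faster than its partial sums, such that for small index sets
`I`, `J` the relation `Δ (x_I) = Δ (x_J)` is decided by the relative position of `I` and `J`, which
is recorded by a word (`exists_generic_sequence`); the truth value is that of a statement with iterated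
quantifiers `∀ᶠ a in U`. By idempotence a letter of a word may be doubled. If `i ∈ I \ J`
and `Δ (x_I) = Δ (x_J)`, doubling the letter of `i` does not change `x_J`, and hence
the color of `x_I` is the same whether the place of `i` is taken by a generic `a`, by a later `b`, or
by `a + b` (`generic_split`). After sums of generic elements are merged this says one of

* `Δ (a + b) = Δ b` generically, if `i` is the minimum of `I`;
* `Δ (a + b) = Δ a` generically, if `i` is the maximum of `I`;
* `Δ (a + b + c) = Δ (a + c)` generically, if `i` is neither.

If `Δ a = Δ b` generically, the sequence follows `mono`. Otherwise it follows `max`, `min` or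
`minMax` according to the first of the three that holds, and `rainbow` if none of them does.

*Necessity.* The patterns are forced by a constant coloring, the identity, the binary logarithm
(`max`), the `p`-adic valuation for a prime `p ∣ k` (`min`), and the pair of the valuation and the
logarithm (`minMax`). Logarithms exclude patterns because integers in `[N, 2 * N]` have only two
different ones. For valuations the choice of `p` matters: a sum of `k` integers of valuation `v` that
are congruent modulo a high power of `p` has valuation larger than `v`.
-/

open Filter

namespace KSum

/-! ### Iterated ultrafilter quantifiers along words -/

section Generic

variable (U : Ultrafilter ℕ)

/-- Let `a₁, a₂, …` be chosen one after the other, each generic for `U`, one for each letter of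
the word `w`. `Generic U w Q` says that then `Q p q` holds, where `p` adds up the `aᵢ` whose letter
has first entry `true`, and `q` those whose letter has second entry `true`. So a letter records
whether an index belongs to the first, to the second, or to both of two index sets. -/
def Generic : List (Bool × Bool) → (ℕ → ℕ → Prop) → Prop
  | [], Q => Q 0 0
  | l :: w, Q => ∀ᶠ a in U, Generic w fun p q => Q (cond l.1 a 0 + p) (cond l.2 a 0 + q)

variable {U}

theorem Generic.and_imp {w : List (Bool × Bool)} {Q R S : ℕ → ℕ → Prop} (hQ : Generic U w Q)
    (hR : Generic U w R) (h : ∀ p q, Q p q → R p q → S p q) : Generic U w S := by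
  induction w generalizing Q R S with
  | nil => exact h _ _ hQ hR
  | cons l w ih =>
    simp only [Generic] at hQ hR ⊢
    filter_upwards [hQ, hR] with a h₁ h₂ using ih h₁ h₂ fun p q => h _ _

theorem Generic.imp {w : List (Bool × Bool)} {Q S : ℕ → ℕ → Prop} (hQ : Generic U w Q)
    (h : ∀ p q, Q p q → S p q) : Generic U w S :=
  hQ.and_imp hQ fun p q h₁ _ => h p q h₁

theorem generic_append {u v : List (Bool × Bool)} {Q : ℕ → ℕ → Prop} :
    Generic U (u ++ v) Q ↔
      Generic U u fun p q => Generic U v fun p' q' => Q (p + p') (q + q') := by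
  induction u generalizing Q with
  | nil => simp [Generic]
  | cons l u ih => simp only [List.cons_append, Generic, ih, add_assoc]

theorem generic_snd_false {w : List (Bool × Bool)} (hw : ∀ l ∈ w, l.2 = false)
    {Q : ℕ → ℕ → Prop} : Generic U w Q ↔ Generic U w fun p _ => Q p 0 := by
  induction w generalizing Q with
  | nil => simp [Generic]
  | cons l w ih =>
    simp only [List.forall_mem_cons] at hw
    simp only [Generic, hw.1, cond_false, zero_add]
    exact eventually_congr (Eventually.of_forall fun a => ih hw.2)

theorem generic_fst_false {w : List (Bool × Bool)} (hw : ∀ l ∈ w, l.1 = false) {Q : ℕ → Prop} :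
    (Generic U w fun p _ => Q p) ↔ Q 0 := by
  induction w generalizing Q with
  | nil => simp [Generic]
  | cons l w ih =>
    simp only [List.forall_mem_cons] at hw
    simp [Generic, hw.1, ih hw.2]

/-- `U + U = U`, in terms of quantifiers: the sum of two successive generic elements behaves like
one generic element. -/
def Idempotent (U : Ultrafilter ℕ) : Prop :=
  ∀ Q : ℕ → Prop, (∀ᶠ a in U, ∀ᶠ b in U, Q (a + b)) ↔ ∀ᶠ a in U, Q a

/-- By idempotence, the sum of any positive number of generic elements behaves like one. -/
theorem generic_fst_true (hU : Idempotent U) {w : List (Bool × Bool)}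
    (hw : ∃ l ∈ w, l.1 = true) {Q : ℕ → Prop} :
    (Generic U w fun p _ => Q p) ↔ ∀ᶠ a in U, Q a := by
  induction w generalizing Q with
  | nil => simp at hw
  | cons l w ih =>
    by_cases h : ∃ l ∈ w, l.1 = true
    · simp only [Generic, ih h (Q := fun p => Q (_ + p))]
      cases l.1
      · simp
      · simpa using hU Q
    · have hl : l.1 = true := by
        simp only [List.exists_mem_cons_iff] at hw
        exact hw.resolve_right h
      have h' : ∀ l ∈ w, l.1 = false := by simpa using h
      simp only [Generic, hl, cond_true, generic_fst_false h' (Q := fun p => Q (_ + p)), add_zero]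

/-- The Ellis–Numakura lemma, applied to the positive integers: there an idempotent ultrafilter
is automatically nonprincipal. -/
theorem exists_idempotent_ultrafilter :
    ∃ U : Ultrafilter ℕ, Idempotent U ∧ ∀ N : ℕ, ∀ᶠ a in U, N < a := by
  let := Ultrafilter.addSemigroup (M := ℕ+)
  obtain ⟨V, hV⟩ := exists_idempotent_of_compact_t2_of_continuous_add_left
    (M := Ultrafilter ℕ+) Ultrafilter.continuous_add_left
  have key : ∀ Q : ℕ+ → Prop, (∀ᶠ a in V, ∀ᶠ b in V, Q (a + b)) ↔ ∀ᶠ a in V, Q a := by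
    intro Q
    conv_rhs => rw [← hV]
    exact (Ultrafilter.eventually_add V V Q).symm
  refine ⟨V.map (↑), fun Q => ?_, fun N => ?_⟩
  · simpa using key fun a => Q a
  -- otherwise the idempotent ultrafilter is principal at some `n` with `n + n = n`
  · simp only [Ultrafilter.coe_map, eventually_map]
    by_contra h
    rw [← Ultrafilter.eventually_not] at h
    have hfin : {a : ℕ+ | ¬ N < (a : ℕ)}.Finite :=
      ((Set.finite_Iic N).preimage PNat.coe_injective.injOn).subset fun a ha => by
        simpa using ha
    obtain ⟨n, -, hn⟩ := Ultrafilter.eq_pure_of_finite_mem hfin h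
    subst hn
    have := (key (· = n)).2 (by simp)
    have : n + n = n := by simpa using this
    exact absurd (congrArg PNat.val this) (by simp)

theorem exists_diagonal {A : ℕ → Set ℕ} (hA : ∀ N, (A N).Nonempty) :
    ∃ x : ℕ → ℕ, ∀ n, x n ∈ A (∑ i ∈ Finset.range n, x i) := by
  choose f hf using hA
  let S : ℕ → ℕ := fun n => Nat.rec 0 (fun _ s => s + f s) n
  have hS : ∀ n, ∑ i ∈ Finset.range n, f (S i) = S n := by
    intro n
    induction n with
    | zero => rfl
    | succ n ih => rw [Finset.sum_range_succ, ih]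
  exact ⟨fun n => f (S n), fun n => by simpa only [hS] using hf (S n)⟩

/-- The relative position of two index sets: for each element of `I ∪ J`, in increasing order, the
two truth values of membership in `I` and in `J`. -/
def word (I J : Finset ℕ) : List (Bool × Bool) :=
  ((I ∪ J).sort (· ≤ ·)).map fun i => (decide (i ∈ I), decide (i ∈ J))

/-- There is a rapidly growing sequence for which the truth of `Δ (x_I) = Δ (x_J)` depends only on
the relative position of the index sets, and is the generic truth value. Each `x n` is taken in a
set of `U` that works for all pairs of partial sums up to `x 0 + ⋯ + x (n - 1)` and for all
short remaining words; these are finitely many conditions. -/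
theorem exists_generic_sequence (hN : ∀ N : ℕ, ∀ᶠ a in U, N < a) (Δ : ℕ → ℕ) (L : ℕ) :
    ∃ x : ℕ → ℕ, (∀ n, ∑ i ∈ Finset.range n, x i < x n) ∧
      ∀ I J : Finset ℕ, (I ∪ J).card ≤ L →
        (Δ (∑ i ∈ I, x i) = Δ (∑ j ∈ J, x j) ↔
          Generic U (word I J) fun p q => Δ p = Δ q) := by
  -- `T w p q`: generic equality of colors if `w` remains to be read and `p`, `q` are the partial sums
  let T : List (Bool × Bool) → ℕ → ℕ → Prop := fun w p q =>
    Generic U w fun p' q' => Δ (p + p') = Δ (q + q')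
  have hT : ∀ l w p q, T (l :: w) p q ↔
      ∀ᶠ a in U, T w (p + cond l.1 a 0) (q + cond l.2 a 0) := fun l w p q => by
    simp only [T, Generic, add_assoc]
  have hA : ∀ N, {a | N < a ∧ ∀ p ∈ Set.Iic N, ∀ q ∈ Set.Iic N,
      ∀ w ∈ {w : List (Bool × Bool) | w.length ≤ L}, ∀ l,
        (T (l :: w) p q ↔ T w (p + cond l.1 a 0) (q + cond l.2 a 0))}.Nonempty := by
    intro N
    refine Eventually.exists (f := (U : Filter ℕ)) ((hN N).and ?_)
    rw [eventually_all_finite (Set.finite_Iic N)]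
    intro p _
    rw [eventually_all_finite (Set.finite_Iic N)]
    intro q _
    rw [eventually_all_finite (List.finite_length_le _ L)]
    intro w _
    rw [eventually_all]
    intro l
    by_cases h : T (l :: w) p q
    · simpa only [h, true_iff] using (hT l w p q).1 h
    · simp only [h, false_iff]
      rw [hT, ← Ultrafilter.eventually_not] at h
      exact h
  obtain ⟨x, hx⟩ := exists_diagonal hA
  have key : ∀ (f : ℕ → Bool × Bool) (l : List ℕ), l.Pairwise (· < ·) → l.length ≤ L →
      ∀ p q, (∀ i ∈ l, p ≤ ∑ j ∈ Finset.range i, x j ∧ q ≤ ∑ j ∈ Finset.range i, x j) →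
      (T (l.map f) p q ↔ Δ (p + (l.map fun i => cond (f i).1 (x i) 0).sum) =
        Δ (q + (l.map fun i => cond (f i).2 (x i) 0).sum)) := by
    intro f l
    induction l with
    | nil => intros; simp [T, Generic]
    | cons i l ih =>
      intro hl hL p q hpq
      simp only [List.pairwise_cons, List.length_cons, List.forall_mem_cons] at hl hL hpq
      have hc : ∀ b, cond b (x i) 0 ≤ x i := fun b => by cases b <;> simp
      rw [List.map_cons, (hx i).2 p hpq.1.1 q hpq.1.2 (l.map f) (by simp; omega) (f i),
        ih hl.2 (by omega)]
      · simp [add_assoc]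
      · intro j hj
        have h₁ : ∑ m ∈ Finset.range (i + 1), x m ≤ ∑ m ∈ Finset.range j, x m :=
          Finset.sum_le_sum_of_subset (by simpa using hl.1 j hj)
        rw [Finset.sum_range_succ] at h₁
        have := hc (f i).1
        have := hc (f i).2
        omega
  refine ⟨x, fun n => (hx n).1, fun I J hIJ => ?_⟩
  have hsum : ∀ K ⊆ I ∪ J, (((I ∪ J).sort (· ≤ ·)).map
      fun i => cond (decide (i ∈ K)) (x i) 0).sum = ∑ i ∈ K, x i := by
    intro K hK
    rw [← List.sum_toFinset _ (Finset.sort_nodup _ _), Finset.sort_toFinset]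
    simp only [Bool.cond_decide, Finset.sum_ite_mem, Finset.inter_eq_right.2 hK]
  have := key (fun i => (decide (i ∈ I), decide (i ∈ J))) ((I ∪ J).sort (· ≤ ·))
    (Finset.sortedLT_sort _).pairwise (by simpa using hIJ) 0 0 (by simp)
  simp only [hsum I Finset.subset_union_left, hsum J Finset.subset_union_right, zero_add,
    T] at this
  exact this.symm

end Generic

/-! ### Sequences that grow faster than their partial sums -/

section Superincreasing

variable {x : ℕ → ℕ}

theorem superincreasing_injective (hx : ∀ n, ∑ i ∈ Finset.range n, x i < x n)
    {I J : Finset ℕ} (h : ∑ i ∈ I, x i = ∑ j ∈ J, x j) : I = J := by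
  have aux : ∀ n, ∀ I ⊆ Finset.range (n + 1), ∀ J ⊆ Finset.range (n + 1), n ∈ I → n ∉ J →
      ∑ i ∈ I, x i ≠ ∑ j ∈ J, x j := by
    intro n I _ J hJ hnI hnJ
    have h₁ : ∑ j ∈ J, x j ≤ ∑ j ∈ Finset.range n, x j :=
      Finset.sum_le_sum_of_subset fun j hj => by
        have := Finset.mem_range.1 (hJ hj)
        have : j ≠ n := fun h => hnJ (h ▸ hj)
        simp only [Finset.mem_range]
        omega
    have h₂ := Finset.single_le_sum (f := x) (fun _ _ => Nat.zero_le _) hnI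
    have := hx n
    omega
  have key : ∀ n, ∀ I ⊆ Finset.range n, ∀ J ⊆ Finset.range n,
      ∑ i ∈ I, x i = ∑ j ∈ J, x j → I = J := by
    intro n
    induction n with
    | zero => intro I hI J hJ _; simp_all
    | succ n ih =>
      intro I hI J hJ h
      have shrink : ∀ K ⊆ Finset.range (n + 1), K.erase n ⊆ Finset.range n := fun K hK i hi => by
        have := Finset.mem_range.1 (hK (Finset.mem_of_mem_erase hi))
        have := Finset.ne_of_mem_erase hi
        simp only [Finset.mem_range]
        omega
      by_cases hnI : n ∈ I <;> by_cases hnJ : n ∈ J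
      · rw [← Finset.insert_erase hnI, ← Finset.insert_erase hnJ]
        rw [← Finset.add_sum_erase _ _ hnI, ← Finset.add_sum_erase _ _ hnJ] at h
        rw [ih _ (shrink I hI) _ (shrink J hJ) (by omega)]
      · exact absurd h (aux n I hI J hJ hnI hnJ)
      · exact absurd h.symm (aux n J hJ I hI hnJ hnI)
      · rw [← Finset.erase_eq_of_notMem hnI, ← Finset.erase_eq_of_notMem hnJ] at h ⊢
        exact ih _ (shrink I hI) _ (shrink J hJ) h
  obtain ⟨n, hn⟩ := (I ∪ J).exists_nat_subset_range
  exact key n I (Finset.subset_union_left.trans hn) J (Finset.subset_union_right.trans hn) h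

theorem superincreasing_enumerates (hx : ∀ n, ∑ i ∈ Finset.range n, x i < x n) :
    Enumerates x :=
  ⟨strictMono_nat_of_lt_succ fun n =>
    (Finset.single_le_sum (f := x) (fun _ _ => Nat.zero_le _) (by simp)).trans_lt (hx (n + 1)),
    fun n => (Nat.zero_le _).trans_lt (hx n)⟩

theorem superincreasing_nondegenerate (hx : ∀ n, ∑ i ∈ Finset.range n, x i < x n) {k : ℕ}
    (hk : 2 ≤ k) : Nondegenerate k x := by
  refine ⟨fun I J _ _ h => superincreasing_injective hx h, ?_⟩
  rw [Set.disjoint_left]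
  rintro _ ⟨i, rfl⟩ ⟨J, hJ, h⟩
  have : J = {i} := superincreasing_injective hx (by simpa using h)
  subst this
  simp at hJ
  omega

end Superincreasing

/-! ### Absorption of summands -/

section Absorption

variable {U : Ultrafilter ℕ} {Δ : ℕ → ℕ}

/-- The first of two successive generic summands does not affect the color of the sum. -/
def AbsorbsLeft (U : Ultrafilter ℕ) (Δ : ℕ → ℕ) : Prop :=
  ∀ᶠ a in U, ∀ᶠ b in U, Δ (a + b) = Δ b

/-- The second of two successive generic summands does not affect the color of the sum. -/
def AbsorbsRight (U : Ultrafilter ℕ) (Δ : ℕ → ℕ) : Prop :=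
  ∀ᶠ a in U, ∀ᶠ b in U, Δ (a + b) = Δ a

/-- The middle one of three successive generic summands does not affect the color of the sum. -/
def AbsorbsMiddle (U : Ultrafilter ℕ) (Δ : ℕ → ℕ) : Prop :=
  ∀ᶠ a in U, ∀ᶠ b in U, ∀ᶠ c in U, Δ (a + b + c) = Δ (a + c)

/-- The key step. Suppose that `Δ (p + a + p') = Δ q` generically, where `a` does not
contribute to `q`. By idempotence `a` may be replaced by `a + b`, or by either of `a` and `b` alone,
without touching `q`. So the three colors obtained on the left coincide. -/
theorem generic_split (hU : Idempotent U) {u v : List (Bool × Bool)}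
    (h : Generic U (u ++ (true, false) :: v) fun p q => Δ p = Δ q) :
    Generic U u fun p _ => ∀ᶠ a in U, ∀ᶠ b in U, Generic U v fun p' _ =>
      Δ (p + (a + b) + p') = Δ (p + a + p') ∧ Δ (p + (a + b) + p') = Δ (p + b + p') := by
  rw [generic_append] at h
  refine h.imp fun p q h => ?_
  simp only [Generic, cond_true, cond_false, zero_add] at h
  have h₂ := (hU _).2 h
  filter_upwards [h, h₂] with a ha hab
  filter_upwards [h, hab] with b hb hab
  refine (ha.and_imp hab fun p' q' h₁ h₂ => And.intro h₁ h₂).and_imp hb fun p' q' h₁ h₂ => ?_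
  simp only [add_assoc] at h₁ h₂ ⊢
  exact ⟨h₁.2.trans h₁.1.symm, h₁.2.trans h₂.symm⟩

theorem absorbsLeft_of_generic (hU : Idempotent U) {u v : List (Bool × Bool)}
    (hu : ∀ l ∈ u, l.1 = false)
    (h : Generic U (u ++ (true, false) :: v) fun p q => Δ p = Δ q) : AbsorbsLeft U Δ := by
  have h := (generic_fst_false hu (Q := fun p => ∀ᶠ a in U, ∀ᶠ b in U, Generic U v fun p' _ =>
    Δ (p + (a + b) + p') = Δ (p + a + p') ∧ Δ (p + (a + b) + p') = Δ (p + b + p'))).1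
    (generic_split hU h)
  by_cases hv : ∃ l ∈ v, l.1 = true
  · filter_upwards [h] with a ha
    refine (hU _).1 ?_
    filter_upwards [ha] with b hb
    filter_upwards [(generic_fst_true hU hv
      (Q := fun c => Δ (a + (b + c)) = Δ (b + c))).1 (hb.imp fun p' _ h => by
        simpa [add_assoc] using h.2)] with c hc using hc
  · filter_upwards [h] with a ha
    filter_upwards [ha] with b hb
    exact (generic_fst_false (by simpa using hv) (Q := fun c => Δ (a + b + c) = Δ (b + c))).1
      (hb.imp fun p' _ h => by simpa using h.2)

theorem absorbsRight_of_generic (hU : Idempotent U) {u v : List (Bool × Bool)}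
    (hv : ∀ l ∈ v, l.1 = false)
    (h : Generic U (u ++ (true, false) :: v) fun p q => Δ p = Δ q) : AbsorbsRight U Δ := by
  have h : Generic U u fun p _ => ∀ᶠ a in U, ∀ᶠ b in U, Δ (p + a + b) = Δ (p + a) := by
    refine (generic_split hU h).imp fun p _ h => ?_
    filter_upwards [h] with a ha
    filter_upwards [ha] with b hb
    exact (generic_fst_false hv (Q := fun c => Δ (p + a + b + c) = Δ (p + a + c))).1
      (hb.imp fun p' _ h => by simpa [add_assoc] using h.1)
  by_cases hu : ∃ l ∈ u, l.1 = true
  · exact (hU _).1 ((generic_fst_true hU hu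
      (Q := fun p => ∀ᶠ a in U, ∀ᶠ b in U, Δ (p + a + b) = Δ (p + a))).1 h)
  · simpa [AbsorbsRight] using (generic_fst_false (by simpa using hu)
      (Q := fun p => ∀ᶠ a in U, ∀ᶠ b in U, Δ (p + a + b) = Δ (p + a))).1 h

theorem absorbsMiddle_of_generic (hU : Idempotent U) {u v : List (Bool × Bool)}
    (hu : ∃ l ∈ u, l.1 = true) (hv : ∃ l ∈ v, l.1 = true)
    (h : Generic U (u ++ (true, false) :: v) fun p q => Δ p = Δ q) : AbsorbsMiddle U Δ := by
  have h : Generic U u fun p _ => ∀ᶠ a in U, ∀ᶠ b in U, ∀ᶠ c in U,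
      Δ (p + a + b + c) = Δ (p + a + c) := by
    refine (generic_split hU h).imp fun p _ h => ?_
    filter_upwards [h] with a ha
    filter_upwards [ha] with b hb
    exact (generic_fst_true hU hv (Q := fun c => Δ (p + a + b + c) = Δ (p + a + c))).1
      (hb.imp fun p' _ h => by simpa [add_assoc] using h.1)
  exact (hU _).1 ((generic_fst_true hU hu (Q := fun p => ∀ᶠ a in U, ∀ᶠ b in U, ∀ᶠ c in U,
      Δ (p + a + b + c) = Δ (p + a + c))).1 h)

end Absorption

/-! ### Words of index sets -/

section Words

/-- Listing a finite set in increasing order splits at each of its elements. -/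
theorem exists_sort_eq_append {S : Finset ℕ} {i : ℕ} (hi : i ∈ S) :
    ∃ s t : List ℕ, S.sort (· ≤ ·) = s ++ i :: t ∧ (∀ j, j ∈ s ↔ j ∈ S ∧ j < i) ∧
      ∀ j, j ∈ t ↔ j ∈ S ∧ i < j := by
  obtain ⟨s, t, h⟩ := List.append_of_mem ((Finset.mem_sort (· ≤ ·)).2 hi)
  have hp : (S.sort (· ≤ ·)).Pairwise (· < ·) := (Finset.sortedLT_sort _).pairwise
  have hm : ∀ j, j ∈ S ↔ j ∈ s ∨ j = i ∨ j ∈ t := fun j => by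
    rw [← Finset.mem_sort (· ≤ ·), h]; simp
  rw [h, List.pairwise_append, List.pairwise_cons] at hp
  obtain ⟨-, ⟨ht, -⟩, hs⟩ := hp
  have hs' : ∀ j ∈ s, j < i := fun j hj => hs j hj i (by simp)
  refine ⟨s, t, h, fun j => ⟨fun hj => ⟨(hm j).2 (.inl hj), hs' j hj⟩, fun hj => ?_⟩,
    fun j => ⟨fun hj => ⟨(hm j).2 (.inr (.inr hj)), ht j hj⟩, fun hj => ?_⟩⟩
  · rcases (hm j).1 hj.1 with h | h | h
    · exact h
    · omega
    · have := ht j h; omega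
  · rcases (hm j).1 hj.1 with h | h | h
    · have := hs' j h; omega
    · omega
    · exact h

variable {U : Ultrafilter ℕ} {Δ : ℕ → ℕ} {I J : Finset ℕ} {i : ℕ}

theorem exists_word_eq_append (hi : i ∈ I) (hJ : i ∉ J) : ∃ u v : List (Bool × Bool),
    word I J = u ++ (true, false) :: v ∧ ((∃ l ∈ u, l.1 = true) ↔ ∃ j ∈ I, j < i) ∧
      ((∃ l ∈ v, l.1 = true) ↔ ∃ j ∈ I, i < j) := by
  obtain ⟨s, t, h, hs, ht⟩ := exists_sort_eq_append (Finset.mem_union_left J hi)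
  refine ⟨_, _, by rw [word, h, List.map_append, List.map_cons, decide_eq_true hi,
    decide_eq_false hJ], ?_, ?_⟩ <;>
  · simp only [List.mem_map, exists_exists_and_eq_and, hs, ht, decide_eq_true_eq, Finset.mem_union]
    exact exists_congr fun j => by tauto

theorem absorbsLeft_of_word (hU : Idempotent U) (hi : i ∈ I) (hJ : i ∉ J) (hmin : ∀ j ∈ I, i ≤ j)
    (h : Generic U (word I J) fun p q => Δ p = Δ q) : AbsorbsLeft U Δ := by
  obtain ⟨u, v, hw, hu, -⟩ := exists_word_eq_append hi hJ
  refine absorbsLeft_of_generic hU (v := v) (u := u) ?_ (hw ▸ h)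
  have : ¬ ∃ l ∈ u, l.1 = true := by rw [hu]; push Not; exact hmin
  simpa using this

theorem absorbsRight_of_word (hU : Idempotent U) (hi : i ∈ I) (hJ : i ∉ J) (hmax : ∀ j ∈ I, j ≤ i)
    (h : Generic U (word I J) fun p q => Δ p = Δ q) : AbsorbsRight U Δ := by
  obtain ⟨u, v, hw, -, hv⟩ := exists_word_eq_append hi hJ
  refine absorbsRight_of_generic hU (v := v) (u := u) ?_ (hw ▸ h)
  have : ¬ ∃ l ∈ v, l.1 = true := by rw [hv]; push Not; exact hmax
  simpa using this

/-- If no summand is absorbed, then different index sets have generically different colors. -/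
theorem absorbs_of_word (hU : Idempotent U) (hi : i ∈ I) (hJ : i ∉ J)
    (h : Generic U (word I J) fun p q => Δ p = Δ q) :
    AbsorbsLeft U Δ ∨ AbsorbsRight U Δ ∨ AbsorbsMiddle U Δ := by
  by_cases h₁ : ∀ j ∈ I, i ≤ j
  · exact .inl (absorbsLeft_of_word hU hi hJ h₁ h)
  by_cases h₂ : ∀ j ∈ I, j ≤ i
  · exact .inr (.inl (absorbsRight_of_word hU hi hJ h₂ h))
  push Not at h₁ h₂
  obtain ⟨u, v, hw, hu, hv⟩ := exists_word_eq_append hi hJ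
  exact .inr (.inr (absorbsMiddle_of_generic hU (hu.2 h₁) (hv.2 h₂) (hw ▸ h)))

theorem generic_word_max (hU : Idempotent U) (h : AbsorbsLeft U Δ) (hI : I.Nonempty) :
    Generic U (word I {I.max' hI}) fun p q => Δ p = Δ q := by
  obtain ⟨s, t, hst, hs, ht⟩ := exists_sort_eq_append (I.max'_mem hI)
  have ht' : t = [] := List.eq_nil_iff_forall_not_mem.2 fun j hj =>
    absurd (I.le_max' j ((ht j).1 hj).1) (not_le.2 ((ht j).1 hj).2)
  rw [word, Finset.union_eq_left.2 (by simpa using I.max'_mem hI), hst, ht', List.map_append,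
    generic_append, generic_snd_false]
  · simp only [List.map_cons, List.map_nil, Generic, I.max'_mem hI, Finset.mem_singleton,
      decide_true, cond_true, add_zero, zero_add]
    by_cases he : ∃ l ∈ s.map fun i => (decide (i ∈ I), decide (i = I.max' hI)), l.1 = true
    · exact (generic_fst_true hU he (Q := fun p => ∀ᶠ a in U, Δ (p + a) = Δ a)).2 h
    · exact (generic_fst_false (by simpa using he) (Q := fun p => ∀ᶠ a in U, Δ (p + a) = Δ a)).2
        (by simp)
  · simp only [List.mem_map, Finset.mem_singleton, forall_exists_index, and_imp]
    rintro _ j hj rfl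
    simpa using ((hs j).1 hj).2.ne

theorem generic_word_min (hU : Idempotent U) (h : AbsorbsRight U Δ) (hI : I.Nonempty) :
    Generic U (word I {I.min' hI}) fun p q => Δ p = Δ q := by
  obtain ⟨s, t, hst, hs, ht⟩ := exists_sort_eq_append (I.min'_mem hI)
  have hs' : s = [] := List.eq_nil_iff_forall_not_mem.2 fun j hj =>
    absurd (I.min'_le j ((hs j).1 hj).1) (not_le.2 ((hs j).1 hj).2)
  rw [word, Finset.union_eq_left.2 (by simpa using I.min'_mem hI), hst, hs']
  simp only [List.nil_append, List.map_cons, Generic, I.min'_mem hI, Finset.mem_singleton,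
      decide_true, cond_true]
  filter_upwards [h] with a ha
  rw [generic_snd_false]
  · simp only [add_zero]
    by_cases he : ∃ l ∈ t.map fun i => (decide (i ∈ I), decide (i = I.min' hI)), l.1 = true
    · exact (generic_fst_true hU he (Q := fun p => Δ (a + p) = Δ a)).2 ha
    · exact (generic_fst_false (by simpa using he) (Q := fun p => Δ (a + p) = Δ a)).2 (by simp)
  · simp only [List.mem_map, forall_exists_index, and_imp]
    rintro _ j hj rfl
    simpa using ((ht j).1 hj).2.ne'

theorem generic_word_min_max (hU : Idempotent U) (h : AbsorbsMiddle U Δ) (hI : I.Nonempty)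
    (hlt : I.min' hI < I.max' hI) :
    Generic U (word I {I.min' hI, I.max' hI}) fun p q => Δ p = Δ q := by
  obtain ⟨s, t, hst, hs, ht⟩ := exists_sort_eq_append (I.max'_mem hI)
  have ht' : t = [] := List.eq_nil_iff_forall_not_mem.2 fun j hj =>
    absurd (I.le_max' j ((ht j).1 hj).1) (not_le.2 ((ht j).1 hj).2)
  obtain ⟨r, hr, hr'⟩ : ∃ r, s = I.min' hI :: r ∧ ∀ j ∈ r, I.min' hI < j ∧ j < I.max' hI := by
    obtain ⟨s', r, hsr, hs', hr⟩ := exists_sort_eq_append (I.min'_mem hI)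
    have hs'' : s' = [] := List.eq_nil_iff_forall_not_mem.2 fun j hj =>
      absurd (I.min'_le j ((hs' j).1 hj).1) (not_le.2 ((hs' j).1 hj).2)
    rw [hst, ht', hs'', List.nil_append] at hsr
    cases s with
    | nil => simp only [List.nil_append, List.cons.injEq] at hsr; omega
    | cons b s =>
      simp only [List.cons_append, List.cons.injEq] at hsr
      refine ⟨s, by rw [hsr.1], fun j hj => ⟨((hr j).1 ?_).2, ((hs j).1 (by simp [hj])).2⟩⟩
      rw [← hsr.2]
      simp [hj]
  rw [word, Finset.union_eq_left.2 (by simp [Finset.insert_subset_iff, I.max'_mem hI,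
    I.min'_mem hI]), hst, ht', hr]
  simp only [List.cons_append, List.map_cons, List.map_append, List.map_nil, Generic, I.min'_mem hI,
    Finset.mem_insert, Finset.mem_singleton, true_or, decide_true, cond_true]
  filter_upwards [h] with a ha
  rw [generic_append, generic_snd_false]
  · simp only [Generic, I.max'_mem hI, or_true, decide_true, cond_true, add_zero, zero_add]
    by_cases he : ∃ l ∈ r.map fun i => (decide (i ∈ I), decide (i = I.min' hI ∨ i = I.max' hI)),
        l.1 = true
    · exact (generic_fst_true hU he
        (Q := fun p => ∀ᶠ c in U, Δ (a + (p + c)) = Δ (a + c))).2 (by simpa only [add_assoc] using ha)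
    · exact (generic_fst_false (by simpa using he)
        (Q := fun p => ∀ᶠ c in U, Δ (a + (p + c)) = Δ (a + c))).2 (by simp)
  · simp only [List.mem_map, forall_exists_index, and_imp]
    rintro _ j hj rfl
    simpa using ⟨(hr' j hj).1.ne', (hr' j hj).2.ne⟩

end Words

/-! ### The five patterns suffice -/

section Existence

variable {k : ℕ} {Δ : ℕ → ℕ}

theorem exists_follows (hk : 2 ≤ k) (Δ : ℕ → ℕ) : ∃ x : ℕ → ℕ, Enumerates x ∧ Nondegenerate k x ∧
    ∃ p : Pattern, Follows k Δ x p := by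
  obtain ⟨U, hU, hN⟩ := exists_idempotent_ultrafilter
  obtain ⟨x, hx, hgen⟩ := exists_generic_sequence hN Δ (2 * k)
  refine ⟨x, superincreasing_enumerates hx, superincreasing_nondegenerate hx hk, ?_⟩
  replace hgen : ∀ I J : Finset ℕ, I.card ≤ k → J.card ≤ k →
      (Δ (∑ i ∈ I, x i) = Δ (∑ j ∈ J, x j) ↔ Generic U (word I J) fun p q => Δ p = Δ q) :=
    fun I J hI hJ => hgen I J (by have := Finset.card_union_le I J; omega)
  have hone : ∀ i : ℕ, ({i} : Finset ℕ).card ≤ k := fun i => by simp; omega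
  have hmax : AbsorbsLeft U Δ → ∀ (J : Finset ℕ) (hJ : J.Nonempty), J.card = k →
      Δ (∑ j ∈ J, x j) = Δ (x (J.max' hJ)) := fun h J hJ hc => by
    simpa using (hgen J {J.max' hJ} hc.le (hone _)).2 (generic_word_max hU h hJ)
  have hmin : AbsorbsRight U Δ → ∀ (J : Finset ℕ) (hJ : J.Nonempty), J.card = k →
      Δ (∑ j ∈ J, x j) = Δ (x (J.min' hJ)) := fun h J hJ hc => by
    simpa using (hgen J {J.min' hJ} hc.le (hone _)).2 (generic_word_min hU h hJ)
  have hpair : ∀ i j, i < j → (Δ (x i) = Δ (x j) ↔ ∀ᶠ a in U, ∀ᶠ b in U, Δ a = Δ b) := by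
    intro i j hij
    have hs : ({i, j} : Finset ℕ).sort (· ≤ ·) = [i, j] := by
      simpa [hij.le] using List.toFinset_sort (· ≤ ·) (l := [i, j]) (by simp [hij.ne])
    have := hgen {i} {j} (hone i) (hone j)
    simpa [word, ← Finset.insert_eq, hs, Generic, hij.ne, hij.ne'] using this
  by_cases h₁ : ∀ᶠ a in U, ∀ᶠ b in U, Δ a = Δ b
  · refine ⟨.mono, ?_⟩
    obtain ⟨c, hc⟩ := h₁.exists
    -- the color `Δ c` is generic, so `a + b` and `b` both have it
    have hl : AbsorbsLeft U Δ := by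
      have hc' := (hU fun b => Δ c = Δ b).2 hc
      filter_upwards [hc'] with a ha
      filter_upwards [ha, hc] with b h h' using h.symm.trans h'
    have hX : ∀ i, Δ (x i) = Δ (x 0) := fun i => by
      rcases Nat.eq_zero_or_pos i with rfl | hi
      · rfl
      · exact ((hpair 0 i hi).2 h₁).symm
    have : ∀ a ∈ Set.range x ∪ sums k x, Δ a = Δ (x 0) := by
      rintro _ (⟨i, rfl⟩ | ⟨J, hJ, rfl⟩)
      · exact hX i
      · have hJ' : J.Nonempty := Finset.card_pos.1 (by omega)
        rw [hmax hl J hJ' hJ, hX]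
    exact fun a ha b hb => (this a ha).trans (this b hb).symm
  have hX : Rainbow Δ (Set.range x) := by
    rintro _ ⟨i, rfl⟩ _ ⟨j, rfl⟩ h
    rcases lt_trichotomy i j with hij | rfl | hij
    · exact absurd ((hpair i j hij).1 h) h₁
    · rfl
    · exact absurd ((hpair j i hij).1 h.symm) h₁
  by_cases h₂ : AbsorbsLeft U Δ
  · exact ⟨.max, hX, hmax h₂⟩
  by_cases h₃ : AbsorbsRight U Δ
  · exact ⟨.min, hX, hmin h₃⟩
  -- from here on, index sets of equal color share their minimum and their maximum
  have hext : ∀ I J : Finset ℕ, I.card ≤ k → J.card ≤ k → Δ (∑ i ∈ I, x i) = Δ (∑ j ∈ J, x j) →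
      ∀ i ∈ I, i ∉ J → (∃ j ∈ I, j < i) ∧ ∃ j ∈ I, i < j := by
    intro I J hI hJ h i hi hiJ
    rw [hgen I J hI hJ] at h
    constructor <;> by_contra! h'
    · exact h₂ (absorbsLeft_of_word hU hi hiJ h' h)
    · exact h₃ (absorbsRight_of_word hU hi hiJ h' h)
  have hmem_min : ∀ (I J : Finset ℕ) (hI : I.Nonempty), I.card ≤ k → J.card ≤ k →
      Δ (∑ i ∈ I, x i) = Δ (∑ j ∈ J, x j) → I.min' hI ∈ J := by
    intro I J hI hIk hJk h
    by_contra hJ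
    obtain ⟨⟨j, hj, hlt⟩, -⟩ := hext I J hIk hJk h _ (I.min'_mem hI) hJ
    exact absurd (I.min'_le j hj) (not_le.2 hlt)
  have hmem_max : ∀ (I J : Finset ℕ) (hI : I.Nonempty), I.card ≤ k → J.card ≤ k →
      Δ (∑ i ∈ I, x i) = Δ (∑ j ∈ J, x j) → I.max' hI ∈ J := by
    intro I J hI hIk hJk h
    by_contra hJ
    obtain ⟨-, ⟨j, hj, hlt⟩⟩ := hext I J hIk hJk h _ (I.max'_mem hI) hJ
    exact absurd (I.le_max' j hj) (not_le.2 hlt)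
  by_cases h₄ : AbsorbsMiddle U Δ
  · refine ⟨.minMax, hX, fun I J hI hJ hIk hJk => ⟨fun h => ?_, fun ⟨h, h'⟩ => ?_⟩, ?_⟩
    · exact ⟨le_antisymm (I.min'_le _ (hmem_min J I hJ hJk.le hIk.le h))
        (J.min'_le _ (hmem_min I J hI hIk.le hJk.le h.symm)),
        le_antisymm (J.le_max' _ (hmem_max I J hI hIk.le hJk.le h.symm))
        (I.le_max' _ (hmem_max J I hJ hJk.le hIk.le h))⟩
    · have hmid : ∀ (K : Finset ℕ) (hK : K.Nonempty), K.card = k →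
          Δ (∑ i ∈ K, x i) = Δ (∑ i ∈ {K.min' hK, K.max' hK}, x i) := fun K hK hKk =>
        (hgen K _ hKk.le (Finset.card_le_two.trans hk)).2 (generic_word_min_max hU h₄ hK
          (K.min'_lt_max'_of_card (by omega)))
      rw [hmid I hI hIk, hmid J hJ hJk, h, h']
    · rw [Set.disjoint_left]
      rintro _ ⟨_, ⟨i, rfl⟩, rfl⟩ ⟨_, ⟨J, hJk, rfl⟩, h⟩
      have hJ : J.Nonempty := Finset.card_pos.1 (by omega)
      have hs : Δ (∑ j ∈ J, x j) = Δ (∑ j ∈ {i}, x j) := by simpa using h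
      have h₅ := hmem_min J {i} hJ hJk.le (hone i) hs
      have h₆ := hmem_max J {i} hJ hJk.le (hone i) hs
      have := J.min'_lt_max'_of_card (by omega)
      simp only [Finset.mem_singleton] at h₅ h₆
      omega
  · have hsub : ∀ I J : Finset ℕ, I.card ≤ k → J.card ≤ k →
        Δ (∑ i ∈ I, x i) = Δ (∑ j ∈ J, x j) → I ⊆ J := by
      intro I J hI hJ h i hi
      by_contra hiJ
      rcases absorbs_of_word hU hi hiJ ((hgen I J hI hJ).1 h) with h | h | h
      exacts [h₂ h, h₃ h, h₄ h]
    refine ⟨.rainbow, ?_⟩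
    have hsum : ∀ a ∈ Set.range x ∪ sums k x, ∃ I : Finset ℕ, I.card ≤ k ∧ ∑ i ∈ I, x i = a := by
      rintro _ (⟨i, rfl⟩ | ⟨J, hJ, rfl⟩)
      · exact ⟨{i}, hone i, by simp⟩
      · exact ⟨J, hJ.le, rfl⟩
    intro a ha b hb h
    obtain ⟨I, hI, rfl⟩ := hsum a ha
    obtain ⟨J, hJ, rfl⟩ := hsum b hb
    rw [(hsub I J hI hJ h).antisymm (hsub J I hJ hI h.symm)]

end Existence

/-! ### Sums of two elements -/

section PairSums

theorem minMax_iff_rainbow_and_nondegenerate {Δ x : ℕ → ℕ} :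
    Follows 2 Δ x .minMax ↔ Follows 2 Δ x .rainbow ∧ Nondegenerate 2 x := by
  have hpair : ∀ (I J : Finset ℕ) (hI : I.Nonempty) (hJ : J.Nonempty), I.card = 2 → J.card = 2 →
      I.min' hI = J.min' hJ → I.max' hI = J.max' hJ → I = J := by
    have : ∀ (K : Finset ℕ) (hK : K.Nonempty), K.card = 2 → {K.min' hK, K.max' hK} = K := by
      intro K hK hc
      refine Finset.eq_of_subset_of_card_le ?_ ?_
      · simp [Finset.insert_subset_iff, K.min'_mem, K.max'_mem]
      · rw [Finset.card_pair (K.min'_lt_max'_of_card (by omega)).ne, hc]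
    intro I J hI hJ hIc hJc h h'
    rw [← this I hI hIc, ← this J hJ hJc, h, h']
  have hne : ∀ J : Finset ℕ, J.card = 2 → J.Nonempty := fun J h => Finset.card_pos.1 (by omega)
  constructor
  · rintro ⟨hX, hiff, hdisj⟩
    rw [Set.disjoint_left] at hdisj
    have hinj : ∀ I J : Finset ℕ, I.card = 2 → J.card = 2 →
        Δ (∑ i ∈ I, x i) = Δ (∑ j ∈ J, x j) → I = J := fun I J hI hJ h =>
      have h' := (hiff I J (hne I hI) (hne J hJ) hI hJ).1 h.symm
      hpair I J _ _ hI hJ h'.1 h'.2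
    refine ⟨?_, fun I J hI hJ h => hinj I J hI hJ (congrArg Δ h), ?_⟩
    · rintro a (ha | ⟨I, hI, rfl⟩) b (hb | ⟨J, hJ, rfl⟩) h
      · exact hX a ha b hb h
      · exact absurd ⟨_, ⟨J, hJ, rfl⟩, h.symm⟩ (hdisj ⟨a, ha, rfl⟩)
      · exact absurd ⟨_, ⟨I, hI, rfl⟩, h⟩ (hdisj ⟨b, hb, rfl⟩)
      · rw [hinj I J hI hJ h]
    · exact Set.disjoint_left.2 fun a ha hs => hdisj ⟨a, ha, rfl⟩ ⟨a, hs, rfl⟩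
  · rintro ⟨hR, hinj, hdisj⟩
    refine ⟨fun a ha b hb => hR a (.inl ha) b (.inl hb), fun I J hI hJ hIc hJc => ⟨fun h => ?_,
      fun h => by rw [hpair I J hI hJ hIc hJc h.1 h.2]⟩, ?_⟩
    · obtain rfl := hinj J I hJc hIc (hR _ (.inr ⟨J, hJc, rfl⟩) _ (.inr ⟨I, hIc, rfl⟩) h)
      simp
    · rw [Set.disjoint_left] at hdisj ⊢
      rintro _ ⟨a, ha, rfl⟩ ⟨b, hb, h⟩
      obtain rfl := hR _ (.inr hb) _ (.inl ha) h
      exact hdisj ha hb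

end PairSums

variable {k : ℕ} {x Δ : ℕ → ℕ}

/-! ### The constant and the injective coloring -/

section Constant

theorem lt_sum_of_mem (hx : Enumerates x) {J : Finset ℕ} (hJ : 2 ≤ J.card) {i : ℕ} (hi : i ∈ J) :
    x i < ∑ j ∈ J, x j := by
  obtain ⟨j, hj, hne⟩ := Finset.exists_mem_ne (by omega : 1 < J.card) i
  exact Finset.single_lt_sum hne hi hj (hx.2 j) fun _ _ _ => Nat.zero_le _

theorem not_follows_of_not_rainbow (h : ¬ Rainbow Δ (Set.range x)) {q : Pattern}
    (hq : q ≠ .mono) : ¬ Follows k Δ x q := by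
  rcases q with _ | _ | _ | _ | _
  · exact absurd rfl hq
  · exact fun h' => h fun a ha b hb => h' a (.inl ha) b (.inl hb)
  · exact fun h' => h h'.1
  · exact fun h' => h h'.1
  · exact fun h' => h h'.1

theorem const_not_follows (hx : Enumerates x) (c : ℕ) {q : Pattern} (hq : q ≠ .mono) :
    ¬ Follows k (fun _ => c) x q :=
  not_follows_of_not_rainbow (fun h => absurd (hx.1.injective
    (h (x 0) ⟨0, rfl⟩ (x 1) ⟨1, rfl⟩ rfl)) (by simp)) hq

theorem id_not_follows (hk : 2 ≤ k) (hx : Enumerates x) {q : Pattern} (hq : q ≠ .rainbow)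
    (hq' : q = .minMax → k ≠ 2) : ¬ Follows k id x q := by
  have hcard : (Finset.range k).card = k := Finset.card_range k
  have hne : (Finset.range k).Nonempty := Finset.card_pos.1 (by omega)
  rcases q with _ | _ | _ | _ | _
  · exact fun h => absurd (hx.1.injective (h (x 0) (.inl ⟨0, rfl⟩) (x 1) (.inl ⟨1, rfl⟩)))
      (by simp)
  · exact absurd rfl hq
  · exact fun h => (lt_sum_of_mem hx (by omega) (Finset.max'_mem _ hne)).ne' (h.2 _ hne hcard)
  · exact fun h => (lt_sum_of_mem hx (by omega) (Finset.min'_mem _ hne)).ne' (h.2 _ hne hcard)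
  · rintro ⟨-, h, -⟩
    have hk3 : 3 ≤ k := by have := hq' rfl; omega
    -- `{0, …, k}` without `1` and without `2`: equal minima and maxima, but different sums
    have hmem : ∀ i, i = 1 ∨ i = 2 → i ∈ Finset.range (k + 1) := fun i hi => by
      simp only [Finset.mem_range]; omega
    have hend : ∀ (i : ℕ), i = 1 ∨ i = 2 → ∀ h : ((Finset.range (k + 1)).erase i).Nonempty,
        ((Finset.range (k + 1)).erase i).min' h = 0 ∧
        ((Finset.range (k + 1)).erase i).max' h = k := by
      intro i hi h
      constructor
      · exact Nat.le_zero.1 (Finset.min'_le _ _ (by simp; omega))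
      · refine le_antisymm (Finset.max'_le _ _ _ fun j hj => ?_)
          (Finset.le_max' _ _ (by simp; omega))
        simp only [Finset.mem_erase, Finset.mem_range] at hj
        omega
    have hc : ∀ i, i = 1 ∨ i = 2 → ((Finset.range (k + 1)).erase i).card = k := fun i hi => by
      simp [Finset.card_erase_of_mem (hmem i hi)]
    have hn : ∀ i, i = 1 ∨ i = 2 → ((Finset.range (k + 1)).erase i).Nonempty := fun i hi =>
      Finset.card_pos.1 (by rw [hc i hi]; omega)
    have h₁ : (1 : ℕ) = 1 ∨ (1 : ℕ) = 2 := .inl rfl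
    have h₂ : (2 : ℕ) = 1 ∨ (2 : ℕ) = 2 := .inr rfl
    have := (h _ _ (hn 1 h₁) (hn 2 h₂) (hc 1 h₁) (hc 2 h₂)).2
      ⟨by rw [(hend 1 h₁ _).1, (hend 2 h₂ _).1], by rw [(hend 1 h₁ _).2, (hend 2 h₂ _).2]⟩
    have e₁ := Finset.sum_erase_add _ x (hmem 1 h₁)
    have e₂ := Finset.sum_erase_add _ x (hmem 2 h₂)
    have e₃ := hx.1 (show 1 < 2 by simp)
    simp only [id_eq] at this
    omega

end Constant

/-! ### Coloring by the binary logarithm -/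

section Log

theorem log_pigeonhole {N a b c : ℕ} (hN : 0 < N) (ha : N ≤ a) (ha' : a ≤ 2 * N) (hb : N ≤ b)
    (hb' : b ≤ 2 * N) (hc : N ≤ c) (hc' : c ≤ 2 * N) :
    Nat.log 2 a = Nat.log 2 b ∨ Nat.log 2 b = Nat.log 2 c ∨ Nat.log 2 a = Nat.log 2 c := by
  have key : ∀ a, N ≤ a → a ≤ 2 * N →
      Nat.log 2 N ≤ Nat.log 2 a ∧ Nat.log 2 a ≤ Nat.log 2 N + 1 := fun a h h' =>
    ⟨Nat.log_mono_right h, (Nat.log_mono_right h').trans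
      (by rw [mul_comm, Nat.log_mul_base one_lt_two hN.ne'])⟩
  have := key a ha ha'
  have := key b hb hb'
  have := key c hc hc'
  omega

theorem exists_lt_log (hx : Enumerates x) (M : ℕ) : ∃ j, k ≤ j ∧ M < Nat.log 2 (x j) :=
  ⟨max k (2 ^ (M + 1)), le_max_left _ _, Nat.le_log_of_pow_le one_lt_two
    ((le_max_right _ _).trans (hx.1.le_apply))⟩

theorem log_not_follows_mono (hΔ : ∀ a b, Δ a = Δ b → Nat.log 2 a = Nat.log 2 b)
    (hx : Enumerates x) : ¬ Follows k Δ x .mono := fun h => by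
  obtain ⟨j, -, hj⟩ := exists_lt_log (k := 0) hx (Nat.log 2 (x 0))
  exact hj.ne (hΔ _ _ (h (x 0) (.inl ⟨0, rfl⟩) (x j) (.inl ⟨j, rfl⟩)))

theorem log_not_follows_min (hΔ : ∀ a b, Δ a = Δ b → Nat.log 2 a = Nat.log 2 b) (hk : 2 ≤ k)
    (hx : Enumerates x) : ¬ Follows k Δ x .min := by
  rintro ⟨-, h⟩
  obtain ⟨j, hkj, hj⟩ := exists_lt_log (k := k) hx (Nat.log 2 (x 0))
  have hj' : j ∉ Finset.range (k - 1) := by simp; omega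
  have hc : (insert j (Finset.range (k - 1))).card = k := by
    rw [Finset.card_insert_of_notMem hj', Finset.card_range]; omega
  have hmin : (insert j (Finset.range (k - 1))).min' (Finset.insert_nonempty _ _) = 0 :=
    Nat.le_zero.1 (Finset.min'_le _ _ (by simp; omega))
  have h' := hΔ _ _ (h _ (Finset.insert_nonempty _ _) hc)
  rw [hmin] at h'
  have := Nat.log_mono_right (b := 2)
    (lt_sum_of_mem hx (by omega : 2 ≤ (insert j (Finset.range (k - 1))).card)
      (Finset.mem_insert_self _ _)).le
  omega

theorem log_not_follows (hk : 2 ≤ k) (hx : Enumerates x) {q : Pattern} (hq : q ≠ .max) :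
    ¬ Follows k (Nat.log 2) x q := by
  have hS : ∑ i ∈ Finset.range (k - 1), x i < ∑ i ∈ Finset.range (k - 1), x (i + 1) :=
    Finset.sum_lt_sum_of_nonempty (by simp; omega) fun i _ => hx.1 (Nat.lt_succ_self i)
  obtain ⟨s, hs⟩ : ∃ s, s = ∑ i ∈ Finset.range (k - 1), x i := ⟨_, rfl⟩
  obtain ⟨s', hs'⟩ : ∃ s', s' = ∑ i ∈ Finset.range (k - 1), x (i + 1) := ⟨_, rfl⟩
  rw [← hs, ← hs'] at hS
  have hpos : 0 < s := by
    rw [hs]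
    exact Finset.sum_pos (fun i _ => hx.2 i) (by simp; omega)
  -- `x t`, `x t + s` and `x t + s'` all lie in `[x t, 2 * x t]`, where only two colors occur
  let t := k + s'
  have ht : s' ≤ x t := (Nat.le_add_left _ _).trans hx.1.le_apply
  let I := insert t (Finset.range (k - 1))
  let J := insert t ((Finset.range (k - 1)).image (· + 1))
  have htI : t ∉ Finset.range (k - 1) := by simp [t]; omega
  have htJ : t ∉ (Finset.range (k - 1)).image (· + 1) := by simp [t]; omega
  have hI : I.card = k := by
    rw [Finset.card_insert_of_notMem htI, Finset.card_range]; omega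
  have hJ : J.card = k := by
    rw [Finset.card_insert_of_notMem htJ, Finset.card_image_of_injective _ (add_left_injective 1),
      Finset.card_range]
    omega
  have hIs : ∑ i ∈ I, x i = x t + s := by rw [Finset.sum_insert htI, hs]
  have hJs : ∑ i ∈ J, x i = x t + s' := by
    rw [Finset.sum_insert htJ, Finset.sum_image (by simp), hs']
  have hpig := log_pigeonhole (hx.2 t) le_rfl (by omega) (Nat.le_add_right (x t) s) (by omega)
    (Nat.le_add_right (x t) s') (by omega)
  rw [← hIs, ← hJs] at hpig
  rcases q with _ | _ | _ | _ | _
  · exact log_not_follows_mono (fun _ _ h => h) hx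
  · intro h
    have hX : x t ∈ Set.range x ∪ sums k x := .inl ⟨t, rfl⟩
    have hXI : ∑ i ∈ I, x i ∈ Set.range x ∪ sums k x := .inr ⟨I, hI, rfl⟩
    have hXJ : ∑ i ∈ J, x i ∈ Set.range x ∪ sums k x := .inr ⟨J, hJ, rfl⟩
    rcases hpig with e | e | e
    · have := h _ hX _ hXI e; omega
    · have := h _ hXI _ hXJ e; omega
    · have := h _ hX _ hXJ e; omega
  · exact absurd rfl hq
  · exact log_not_follows_min (fun _ _ h => h) hk hx
  · rintro ⟨-, hiff, hdisj⟩
    rw [Set.disjoint_left] at hdisj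
    have hdisj := hdisj ⟨x t, ⟨t, rfl⟩, rfl⟩
    rcases hpig with e | e | e
    · exact hdisj ⟨_, ⟨I, hI, rfl⟩, e.symm⟩
    · have h := ((hiff J I (Finset.insert_nonempty _ _) (Finset.insert_nonempty _ _) hJ hI).1 e).1
      have h₀ : I.min' (Finset.insert_nonempty _ _) ≤ 0 := Finset.min'_le _ _ (by simp [I]; omega)
      have h₁ := Finset.min'_mem J (Finset.insert_nonempty _ _)
      rw [h, Nat.le_zero.1 h₀] at h₁
      simp [J, t] at h₁
      omega
    · exact hdisj ⟨_, ⟨J, hJ, rfl⟩, e.symm⟩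

end Log

/-! ### Colorings that involve a valuation -/

section Valuation

variable {p : ℕ} [hp : Fact p.Prime]

theorem padicValNat_eq_of_modEq {m n M : ℕ} (hm : m ≠ 0) (hn : n ≠ 0) (h : n ≡ m [MOD M])
    (hM : p ^ (padicValNat p m + 1) ∣ M) : padicValNat p n = padicValNat p m := by
  refine le_antisymm (Nat.lt_succ_iff.1 (not_le.1 fun hlt => ?_)) ?_
  · rw [← padicValNat_dvd_iff_le hn, h.dvd_iff hM, padicValNat_dvd_iff_le hm] at hlt
    omega
  · rw [← padicValNat_dvd_iff_le hn, h.dvd_iff ((pow_dvd_pow p (Nat.le_succ _)).trans hM),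
      padicValNat_dvd_iff_le hm]

theorem padicValNat_sum_eq (hx : Enumerates x) {i : ℕ} {J : Finset ℕ} (hi : i ∈ J)
    (h : ∀ j ∈ J, j ≠ i → padicValNat p (x i) < padicValNat p (x j)) :
    padicValNat p (∑ j ∈ J, x j) = padicValNat p (x i) := by
  rw [← Finset.add_sum_erase _ _ hi]
  have hxi := hx.2 i
  refine padicValNat_eq_of_modEq hxi.ne' (by omega) (M := p ^ (padicValNat p (x i) + 1)) ?_ dvd_rfl
  have : p ^ (padicValNat p (x i) + 1) ∣ ∑ j ∈ J.erase i, x j := Finset.dvd_sum fun j hj =>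
    (padicValNat_dvd_iff_le (hx.2 j).ne').2
      (h j (Finset.mem_of_mem_erase hj) (Finset.ne_of_mem_erase hj))
  simpa using (Nat.ModEq.refl (x i)).add ((Nat.modEq_zero_iff_dvd).2 this)

theorem exists_infinite_mod_eq {Y : Set ℕ} (hY : Y.Infinite) (x : ℕ → ℕ) {M : ℕ} (hM : 0 < M) :
    ∃ r, {i ∈ Y | x i % M = r}.Infinite := by
  by_contra! h
  refine hY ((Set.Finite.biUnion (Set.finite_Iio M) fun r _ => h r).subset fun i hi =>
    Set.mem_biUnion (x := x i % M) (Nat.mod_lt (x i) hM) ⟨hi, rfl⟩)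

/-- Among infinitely many elements of the same valuation `v` there are infinitely many whose
`k`-fold sums all have valuation `padicValNat p k + v`: take elements `y` that are congruent modulo a
high power of `p`, so that a sum of `k` of them is congruent to `k * y`. -/
theorem exists_infinite_padicValNat_sum_eq (hk : k ≠ 0) (hx : Enumerates x) {v : ℕ} {Y : Set ℕ}
    (hY : Y.Infinite) (hv : ∀ i ∈ Y, padicValNat p (x i) = v) :
    ∃ Z ⊆ Y, Z.Infinite ∧ ∀ J : Finset ℕ, ↑J ⊆ Z → J.card = k →
      padicValNat p (∑ j ∈ J, x j) = padicValNat p k + v := by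
  obtain ⟨r, hr⟩ := exists_infinite_mod_eq hY x
    (M := p ^ (padicValNat p k + v + 1)) (pow_pos hp.out.pos _)
  refine ⟨_, fun i hi => hi.1, hr, fun J hJ hJk => ?_⟩
  obtain ⟨i, hi⟩ : J.Nonempty := Finset.card_pos.1 (by omega)
  have hpv : padicValNat p (k * x i) = padicValNat p k + v := by
    rw [padicValNat.mul hk (hx.2 i).ne', hv i (hJ hi).1]
  rw [← hpv]
  refine padicValNat_eq_of_modEq (mul_ne_zero hk (hx.2 i).ne')
    (Finset.sum_pos (fun j _ => hx.2 j) ⟨i, hi⟩).ne' (M := p ^ (padicValNat p k + v + 1)) ?_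
    (by rw [hpv])
  simpa [hJk] using Nat.ModEq.sum (s := J) (g := fun _ => x i) fun j hj =>
    ((hJ hj).2.trans (hJ hi).2.symm : x j ≡ x i [MOD p ^ (padicValNat p k + v + 1)])

/-- Since `p ∣ k`, a sum of `k` integers of the same valuation can have larger valuation, so the
coloring has no `mono` set. If the valuation is injective on `X`, any sum that contains the
element of least valuation gets its color. -/
theorem padicValNat_not_follows (hk : 2 ≤ k) (hpk : p ∣ k) (hx : Enumerates x) {q : Pattern}
    (hq : q ≠ .min) : ¬ Follows k (padicValNat p) x q := by
  have hk0 : 0 < padicValNat p k := one_le_padicValNat_of_dvd (by omega) hpk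
  by_cases hq₁ : q = .mono
  · subst hq₁
    intro h
    obtain ⟨Z, -, hZ, hs⟩ := exists_infinite_padicValNat_sum_eq (p := p) (k := k) (by omega) hx
      Set.infinite_univ fun i _ => h (x i) (.inl ⟨i, rfl⟩) (x 0) (.inl ⟨0, rfl⟩)
    obtain ⟨J, hJ, hJk⟩ := hZ.exists_subset_card_eq k
    have := hs J hJ hJk
    have := h (x 0) (.inl ⟨0, rfl⟩) _ (.inr ⟨J, hJk, rfl⟩)
    omega
  by_cases hX : Rainbow (padicValNat p) (Set.range x)
  swap
  · exact not_follows_of_not_rainbow hX hq₁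
  let i := Function.argmin (fun i => padicValNat p (x i))
  have hi : ∀ j, j ≠ i → padicValNat p (x i) < padicValNat p (x j) := fun j hj =>
    lt_of_le_of_ne (Function.argmin_le (fun i => padicValNat p (x i)) j) fun h =>
      hj (hx.1.injective (hX _ ⟨j, rfl⟩ _ ⟨i, rfl⟩ h.symm))
  let J := Finset.Ico i (i + k)
  have hiJ : i ∈ J := by simp [J]; omega
  have hJk : J.card = k := by simp [J]
  have hs : padicValNat p (∑ j ∈ J, x j) = padicValNat p (x i) :=
    padicValNat_sum_eq hx hiJ fun j _ hj => hi j hj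
  rcases q with _ | _ | _ | _ | _
  · exact absurd rfl hq₁
  · exact fun h => (lt_sum_of_mem hx (by omega) hiJ).ne'
      (h _ (.inr ⟨J, hJk, rfl⟩) _ (.inl ⟨i, rfl⟩) hs)
  · rintro ⟨-, h⟩
    have hmax : i + 1 ≤ J.max' ⟨i, hiJ⟩ := Finset.le_max' _ _ (by simp [J]; omega)
    exact (hi _ (by omega)).ne (hs.symm.trans (h J ⟨i, hiJ⟩ hJk))
  · exact absurd rfl hq
  · rintro ⟨-, -, h⟩
    exact Set.disjoint_left.1 h ⟨x i, ⟨i, rfl⟩, rfl⟩ ⟨_, ⟨J, hJk, rfl⟩, hs⟩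

/-- The coloring by the `p`-adic valuation and the binary logarithm, where `p ∣ k`. The logarithm
excludes `mono` and `min`, the valuation excludes `max`, and `rainbow` fails because two sums
that differ in one term, neither the smallest nor the largest, can be given the same color. Such a
term exists if `3 ≤ k`. -/
theorem pairColoring_not_follows (hk : 2 ≤ k) (hpk : p ∣ k) (hx : Enumerates x) {q : Pattern}
    (hq : q ≠ .minMax) (hq' : q = .rainbow → k ≠ 2) :
    ¬ Follows k (fun n => Nat.pair (padicValNat p n) (Nat.log 2 n)) x q := by
  have hk0 : 0 < padicValNat p k := one_le_padicValNat_of_dvd (by omega) hpk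
  have hlog : ∀ a b, Nat.pair (padicValNat p a) (Nat.log 2 a) =
      Nat.pair (padicValNat p b) (Nat.log 2 b) → Nat.log 2 a = Nat.log 2 b :=
    fun a b h => (Nat.pair_eq_pair.1 h).2
  have hval : ∀ a b, Nat.pair (padicValNat p a) (Nat.log 2 a) =
      Nat.pair (padicValNat p b) (Nat.log 2 b) → padicValNat p a = padicValNat p b :=
    fun a b h => (Nat.pair_eq_pair.1 h).1
  -- either the valuation is constant on an infinite set, or almost all valuations exceed the first
  have hdich : (∃ v, ∃ Z : Set ℕ, Z.Infinite ∧ (∀ i ∈ Z, padicValNat p (x i) = v) ∧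
      ∀ J : Finset ℕ, ↑J ⊆ Z → J.card = k →
        padicValNat p (∑ j ∈ J, x j) = padicValNat p k + v) ∨
      {i | padicValNat p (x 0) < padicValNat p (x i)}.Infinite := by
    by_cases h : ∃ v, {i | padicValNat p (x i) = v}.Infinite
    · obtain ⟨v, hv⟩ := h
      obtain ⟨Z, hZv, hZ, hs⟩ := exists_infinite_padicValNat_sum_eq (p := p) (k := k) (by omega) hx
        hv fun i hi => hi
      exact .inl ⟨v, Z, hZ, fun i hi => hZv hi, hs⟩
    · right
      push Not at h
      have hfin : {i | padicValNat p (x i) ≤ padicValNat p (x 0)}.Finite :=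
        ((Set.finite_Iic (padicValNat p (x 0))).biUnion fun v _ => h v).subset
          fun i hi => Set.mem_biUnion (show padicValNat p (x i) ∈ Set.Iic _ from hi) rfl
      simpa [Set.compl_ofPred] using hfin.infinite_compl
  rcases q with _ | _ | _ | _ | _
  · exact log_not_follows_mono hlog hx
  · have hk3 : 3 ≤ k := by have := hq' rfl; omega
    intro hR
    -- infinitely many `x z` occur, with all but two summands fixed, in sums of one valuation `e`
    obtain ⟨e, b, Z, hZ, hs⟩ : ∃ e b, ∃ Z : Set ℕ, Z.Infinite ∧ ∀ z ∈ Z, ∀ t ∈ Z, z < t →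
        x z + (x t + b) ∈ sums k x ∧ padicValNat p (x z + (x t + b)) = e := by
      rcases hdich with ⟨v, Z, hZ, -, hs⟩ | hZ
      · obtain ⟨B, hB, hBk⟩ := hZ.exists_subset_card_eq (k - 2)
        refine ⟨padicValNat p k + v, ∑ i ∈ B, x i, Z \ B, hZ.sdiff B.finite_toSet,
          fun z hz t ht hzt => ?_⟩
        have htB : t ∉ B := ht.2
        have hzB : z ∉ insert t B := by
          simp only [Finset.mem_insert, not_or]
          exact ⟨hzt.ne, hz.2⟩
        have hc : (insert z (insert t B)).card = k := by
          rw [Finset.card_insert_of_notMem hzB, Finset.card_insert_of_notMem htB]; omega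
        rw [← Finset.sum_insert htB, ← Finset.sum_insert hzB]
        refine ⟨⟨_, hc, rfl⟩, hs _ ?_ hc⟩
        simp [Set.insert_subset_iff, hB, hz.1, ht.1]
      · obtain ⟨B, hB, hBk⟩ := hZ.exists_subset_card_eq (k - 3)
        refine ⟨padicValNat p (x 0), ∑ i ∈ insert 0 B, x i, _ \ B, hZ.sdiff B.finite_toSet,
          fun z hz t ht hzt => ?_⟩
        have hne : ∀ i, padicValNat p (x 0) < padicValNat p (x i) → i ≠ 0 := by
          rintro _ h rfl
          exact lt_irrefl _ h
        have h0B : 0 ∉ B := fun h => hne 0 (hB h) rfl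
        have htB : t ∉ insert 0 B := by
          simp only [Finset.mem_insert, not_or]
          exact ⟨hne t ht.1, ht.2⟩
        have hzB : z ∉ insert t (insert 0 B) := by
          simp only [Finset.mem_insert, not_or]
          exact ⟨hzt.ne, hne z hz.1, hz.2⟩
        have hc : (insert z (insert t (insert 0 B))).card = k := by
          rw [Finset.card_insert_of_notMem hzB, Finset.card_insert_of_notMem htB,
            Finset.card_insert_of_notMem h0B]; omega
        rw [← Finset.sum_insert htB, ← Finset.sum_insert hzB]
        refine ⟨⟨_, hc, rfl⟩, padicValNat_sum_eq hx (by simp) fun j hj hj0 => ?_⟩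
        simp only [Finset.mem_insert] at hj
        rcases hj with rfl | rfl | rfl | hj
        exacts [hz.1, ht.1, absurd rfl hj0, hB hj]
    obtain ⟨z₁, hz₁, -⟩ := hZ.exists_gt 0
    obtain ⟨z₂, hz₂, h₁₂⟩ := hZ.exists_gt z₁
    obtain ⟨z₃, hz₃, h₂₃⟩ := hZ.exists_gt z₂
    -- a last summand that exceeds all the rest leaves room for two values of the logarithm only
    obtain ⟨t, ht, hlt⟩ := hZ.exists_gt (z₃ + x z₃ + b)
    have hxt : t ≤ x t := hx.1.le_apply
    have hx₁₂ := hx.1 h₁₂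
    have hx₂₃ := hx.1 h₂₃
    have hs₁ := hs z₁ hz₁ t ht (by omega)
    have hs₂ := hs z₂ hz₂ t ht (by omega)
    have hs₃ := hs z₃ hz₃ t ht (by omega)
    have hinj : ∀ a ∈ sums k x, ∀ a' ∈ sums k x, padicValNat p a = e → padicValNat p a' = e →
        Nat.log 2 a = Nat.log 2 a' → a = a' := fun a ha a' ha' h h' hl =>
      hR a (.inr ha) a' (.inr ha') (by simp only [h, h', hl])
    rcases log_pigeonhole (a := x z₁ + (x t + b)) (b := x z₂ + (x t + b)) (c := x z₃ + (x t + b))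
      (hx.2 t) (by omega) (by omega) (by omega) (by omega) (by omega) (by omega) with h | h | h
    · have := hinj _ hs₁.1 _ hs₂.1 hs₁.2 hs₂.2 h; omega
    · have := hinj _ hs₂.1 _ hs₃.1 hs₂.2 hs₃.2 h; omega
    · have := hinj _ hs₁.1 _ hs₃.1 hs₁.2 hs₃.2 h; omega
  · rintro ⟨-, h⟩
    rcases hdich with ⟨v, Z, hZ, hv, hs⟩ | hZ
    · obtain ⟨J, hJ, hJk⟩ := hZ.exists_subset_card_eq k
      have hne : J.Nonempty := Finset.card_pos.1 (by omega)
      have h₁ := hval _ _ (h J hne hJk)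
      rw [hs J hJ hJk, hv _ (hJ (J.max'_mem hne))] at h₁
      omega
    · obtain ⟨B, hB, hBk⟩ := hZ.exists_subset_card_eq (k - 1)
      have h0B : 0 ∉ B := fun h => lt_irrefl (padicValNat p (x 0)) (hB h)
      have hc : (insert 0 B).card = k := by rw [Finset.card_insert_of_notMem h0B]; omega
      have h₁ := hval _ _ (h (insert 0 B) (Finset.insert_nonempty _ _) hc)
      have hlt : ∀ j ∈ insert 0 B, j ≠ 0 → padicValNat p (x 0) < padicValNat p (x j) :=
        fun j hj hj0 => hB ((Finset.mem_insert.1 hj).resolve_left hj0)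
      rw [padicValNat_sum_eq hx (Finset.mem_insert_self 0 B) hlt] at h₁
      refine (hlt _ (Finset.max'_mem _ (Finset.insert_nonempty _ _)) ?_).ne h₁
      obtain ⟨j, hj⟩ : B.Nonempty := Finset.card_pos.1 (by omega)
      have := Finset.le_max' (insert 0 B) j (Finset.mem_insert_of_mem hj)
      have : j ≠ 0 := fun h => h0B (h ▸ hj)
      omega
  · exact log_not_follows_min hlog hk hx
  · exact absurd rfl hq

end Valuation

end KSum

theorem theorem3p1 (k : ℕ) (hk : 2 ≤ k) :
    -- every coloring admits an infinite set that follows one of the five patterns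
    (∀ Δ : ℕ → ℕ, ∃ x : ℕ → ℕ, KSum.Enumerates x ∧ KSum.Nondegenerate k x ∧
      ∃ p : KSum.Pattern, KSum.Follows k Δ x p) ∧
    -- patterns (ii) and (v) coincide for k = 2
    (k = 2 → ∀ Δ x : ℕ → ℕ, KSum.Enumerates x →
      (KSum.Follows k Δ x .minMax ↔
        KSum.Follows k Δ x .rainbow ∧ KSum.Nondegenerate k x)) ∧
    -- no pattern can be omitted
    (∀ p : KSum.Pattern, ∃ Δ : ℕ → ℕ, ∀ x : ℕ → ℕ, KSum.Enumerates x →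
      ∀ q : KSum.Pattern, ¬ KSum.SamePattern k p q → ¬ KSum.Follows k Δ x q) := by
  refine ⟨KSum.exists_follows hk, ?_, fun p => ?_⟩
  · rintro rfl Δ x -
    exact KSum.minMax_iff_rainbow_and_nondegenerate
  have : Fact k.minFac.Prime := ⟨Nat.minFac_prime (by omega)⟩
  have hsame : ∀ q, ¬ KSum.SamePattern k p q → q ≠ p := fun q h hq => h (.inl hq.symm)
  cases p with
  | mono => exact ⟨fun _ => 0, fun x hx q hq => KSum.const_not_follows hx 0 (hsame q hq)⟩
  | rainbow => exact ⟨id, fun x hx q hq => KSum.id_not_follows hk hx (hsame q hq)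
      fun h hk2 => hq (.inr ⟨hk2, .inl ⟨rfl, h⟩⟩)⟩
  | max => exact ⟨Nat.log 2, fun x hx q hq => KSum.log_not_follows hk hx (hsame q hq)⟩
  | min => exact ⟨padicValNat k.minFac, fun x hx q hq =>
      KSum.padicValNat_not_follows hk (Nat.minFac_dvd k) hx (hsame q hq)⟩
  | minMax => exact ⟨fun n => Nat.pair (padicValNat k.minFac n) (Nat.log 2 n), fun x hx q hq =>
      KSum.pairColoring_not_follows hk (Nat.minFac_dvd k) hx (hsame q hq)
        fun h hk2 => hq (.inr ⟨hk2, .inr ⟨rfl, h⟩⟩)⟩
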